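/- All graphs are finite and simple. A graph is an $\mathrm{APUD}(1,1)$ if it is the intersection graph of closed disks of radius $1$ in the Euclidean plane, each centered on the $x$-axis or on the $y$-axis. For a fixed graph $H$, an $H$-representation of a graph assigns to each of its vertices a connected (nonempty) subgraph of one fixed subdivision of $H$ so that two distinct vertices are adjacent if and only if their subgraphs share a vertex; a graph is an $H$-graph if it has an $H$-representation. A Helly circular-arc graph is the intersection graph of arcs of a circle in which the arcs of every clique have a common point. $W_4$ is the wheel on five vertices: a cycle $C_4$ together with a vertex adjacent to all four vertices of the cycle. Let $G$ be a connected $\mathrm{APUD}(1,1)$, and let $\mathcal{L}^*$ be the set of all vertices of $G$ that appear in induced $C_4$s of $G$. Let $H$ be the graph consisting of one cycle with $4$ rays (paths) attached to it, at four distinct vertices of the cycle. Then the induced subgraph $G[\mathcal{L}^*]$ is an $H$-graph. Moreover, if $G[\mathcal{L}^*]$ contains no induced $W_4$, then for every $H$-representation of $G[\mathcal{L}^*]$ the subgraph of $G$ induced by the vertices placed on the cycle (those whose subgraph contains a vertex of the subdivided cycle) is a Helly circular-arc graph. -/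

import Mathlib

namespace APUD

universe u v w

/-- `G` is an axes-parallel unit disk graph with one horizontal and one vertical line
(the coordinate axes): the intersection graph of closed disks of radius `1` in the Euclidean
plane, each centered on one of the two axes. -/
def IsAPUD11 {V : Type u} (G : SimpleGraph V) : Prop :=
  ∃ center : V → EuclideanSpace ℝ (Fin 2),
    (∀ x, center x 1 = 0 ∨ center x 0 = 0) ∧
    ∀ x y, x ≠ y →
      (G.Adj x y ↔ (Metric.closedBall (center x) 1 ∩ Metric.closedBall (center y) 1).Nonempty)

/-- The set of all vertices lying on some induced `C₄` of `G`. -/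
def inducedC4Vertices {V : Type u} (G : SimpleGraph V) : Set V :=
  {x | ∃ f : SimpleGraph.cycleGraph 4 ↪g G, x ∈ Set.range f}

/-- The wheel `W₄` (five vertices): the cycle `C₄` on `some 0, …, some 3` together with the
universal vertex `none`. -/
def wheel4 : SimpleGraph (Option (Fin 4)) where
  Adj
    | some i, some j => (SimpleGraph.cycleGraph 4).Adj i j
    | some _, none => True
    | none, some _ => True
    | none, none => False
  symm := ⟨by
    rintro (_ | i) (_ | j) h
    · exact h
    · trivial
    · trivial
    · exact SimpleGraph.Adj.symm h⟩
  loopless := ⟨by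
    rintro (_ | i) h
    · exact h
    · exact SimpleGraph.irrefl _ h⟩

/-- The cycle with four rays attached: `Sum.inl 0, …, Sum.inl 3` form a cycle, and the ray
attached at `Sum.inl i` is the edge from `Sum.inl i` to `Sum.inr i`. -/
def cycleWithFourRays : SimpleGraph (Fin 4 ⊕ Fin 4) where
  Adj
    | Sum.inl i, Sum.inl j => (SimpleGraph.cycleGraph 4).Adj i j
    | Sum.inl i, Sum.inr j => i = j
    | Sum.inr i, Sum.inl j => i = j
    | Sum.inr _, Sum.inr _ => False
  symm := ⟨by
    rintro (i | i) (j | j) h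
    · exact SimpleGraph.Adj.symm h
    · exact Eq.symm h
    · exact Eq.symm h
    · exact h⟩
  loopless := ⟨by
    rintro (i | i) h
    · exact SimpleGraph.irrefl _ h
    · exact h⟩

/-- A presentation of `K` as a subdivision of `H`: the vertices of `H` are vertices of `K`
(`branch`), every edge of `H` is replaced by a path of `K` between its ends, paths of distinct
edges meet only in common ends, and these paths and the branch vertices make up all of `K`. -/
structure Subdivision {W : Type w} {U : Type v} (H : SimpleGraph W) (K : SimpleGraph U) where
  branch : W ↪ U
  path : ∀ {a b : W}, H.Adj a b → K.Walk (branch a) (branch b)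
  isPath : ∀ {a b : W} (h : H.Adj a b), (path h).IsPath
  path_symm : ∀ {a b : W} (h : H.Adj a b), path h.symm = (path h).reverse
  branch_mem : ∀ {a b : W} (h : H.Adj a b) (c : W),
    branch c ∈ (path h).support → c = a ∨ c = b
  disjoint : ∀ {a b c d : W} (h : H.Adj a b) (h' : H.Adj c d), s(a, b) ≠ s(c, d) →
    ∀ x, x ∈ (path h).support → x ∈ (path h').support →
      ∃ e, e ∈ s(a, b) ∧ e ∈ s(c, d) ∧ x = branch e
  vertex_cover : ∀ x : U, x ∈ Set.range branch ∨
    ∃ (a b : W) (h : H.Adj a b), x ∈ (path h).support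
  edge_cover : ∀ e ∈ K.edgeSet, ∃ (a b : W) (h : H.Adj a b), e ∈ (path h).edges

/-- The vertices of the subdivision `K` that lie on subdivided edges of `H` with both ends
in `A`. -/
def Subdivision.region {W : Type w} {U : Type v} {H : SimpleGraph W} {K : SimpleGraph U}
    (S : Subdivision H K) (A : Set W) : Set U :=
  {x | ∃ (a b : W) (h : H.Adj a b), a ∈ A ∧ b ∈ A ∧ x ∈ (S.path h).support}

/-- An `H`-representation of `G`: a subdivision of `H`, and for each vertex of `G` a connected
(in particular nonempty) subgraph of it, given by its vertex set, such that distinct vertices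
are adjacent exactly if their subgraphs intersect. -/
structure HRepresentation {W : Type w} {V : Type u} (H : SimpleGraph W) (G : SimpleGraph V) where
  host : Type
  graph : SimpleGraph host
  subdivision : Subdivision H graph
  model : V → Set host
  connected : ∀ x, (graph.induce (model x)).Connected
  adj_iff : ∀ x y, x ≠ y → (G.Adj x y ↔ (model x ∩ model y).Nonempty)

/-- `G` is an `H`-graph. -/
def IsHGraph {W : Type w} {V : Type u} (H : SimpleGraph W) (G : SimpleGraph V) : Prop :=
  Nonempty (HRepresentation H G)

/-- The vertices of `G` placed on the cycle by a representation on the cycle with four rays: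
those whose subgraph uses a point of the (subdivided) cycle. -/
def HRepresentation.onCycle {V : Type u} {G : SimpleGraph V}
    (R : HRepresentation cycleWithFourRays G) : Set V :=
  {x | (R.model x ∩ R.subdivision.region (Set.range Sum.inl)).Nonempty}

/-- A closed arc of the circle `ℝ / ℤ`: the image of a compact interval. Single points and the
whole circle are arcs. -/
def IsArc (A : Set (AddCircle (1 : ℝ))) : Prop :=
  ∃ s t : ℝ, s ≤ t ∧ A = (fun r : ℝ => (r : AddCircle (1 : ℝ))) '' Set.Icc s t

/-- `G` is a Helly circular-arc graph: it is the intersection graph of arcs of a circle such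
that the arcs of every clique have a common point. -/
def IsHellyCircularArc {V : Type u} (G : SimpleGraph V) : Prop :=
  ∃ arc : V → Set (AddCircle (1 : ℝ)),
    (∀ x, IsArc (arc x)) ∧
    (∀ x y, x ≠ y → (G.Adj x y ↔ (arc x ∩ arc y).Nonempty)) ∧
    ∀ Q : Set V, G.IsClique Q → ∃ p, ∀ x ∈ Q, p ∈ arc x

end APUD

/-! ### Geometry of induced four-cycles: polar data. -/

namespace APUD

/-! An induced four-cycle of axis-centered unit disks has one center on each of the four half-axes,
all at distance less than √3 from the origin. So `G[L*]` is described by a direction and a radius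
per vertex (`PolarData`): equal directions are adjacent, opposite ones iff the radii sum to at most
2, neighbouring ones iff the squared radii sum to at most 4.

Place the directions at four equidistant points of a circle of length 16. A suitable reach
(`PolarData.reach`) turns these conditions into "reaches sum to at least 8" and "at least 4", so
arcs around the four points represent the graph. Rounded to integers, they become balls on the cycle
of a subdivided host (`PolarData.isHGraph`), which never use the rays.

If two opposite vertices are adjacent, one has radius at most 1 and is the hub of a `W₄`
(`PolarData.not_adj_of_opposite`). Without `W₄`, a clique therefore lives in two neighbouring
directions, and arcs of reach 4 − rad² are Helly (`PolarData.exists_mem_arcs`). This makes all of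
`G[L*]` a Helly circular-arc graph, hence also each induced subgraph, whatever the given
representation. -/

theorem closedBall_one_inter_nonempty_iff (p q : EuclideanSpace ℝ (Fin 2)) :
    (Metric.closedBall p 1 ∩ Metric.closedBall q 1).Nonempty ↔
      (p 0 - q 0) ^ 2 + (p 1 - q 1) ^ 2 ≤ 4 := by
  have key : dist p q ≤ 2 ↔ (p 0 - q 0) ^ 2 + (p 1 - q 1) ^ 2 ≤ 4 := by
    rw [EuclideanSpace.dist_eq, Real.sqrt_le_left (by norm_num)]
    simp only [Fin.sum_univ_two, Real.dist_eq, sq_abs]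
    norm_num
  rw [← key]
  constructor
  · rintro ⟨z, hz, hz'⟩
    rw [Metric.mem_closedBall] at hz hz'
    linarith [dist_triangle_left p q z]
  · intro h
    refine ⟨midpoint ℝ p q, ?_, ?_⟩
    · rw [Metric.mem_closedBall, dist_midpoint_left]
      norm_num; linarith
    · rw [Metric.mem_closedBall, dist_midpoint_right]
      norm_num; linarith

/-- The direction (east, north, west, south) of a nonzero point on a coordinate axis. -/
noncomputable def direction (u v : ℝ) : Fin 4 :=
  if v = 0 then if 0 < u then 0 else 2 else if 0 < v then 1 else 3

/-- Polar coordinates for the vertices of a graph: every vertex has a direction and a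
distance to the origin, which together determine adjacency, and which is covered by four-cycles
with one vertex in each direction. -/
structure PolarData {V : Type*} (G : SimpleGraph V) where
  dir : V → Fin 4
  rad : V → ℝ
  rad_pos : ∀ x, 0 < rad x
  rad_sq_lt : ∀ x, rad x ^ 2 < 3
  adj_of_dir_eq : ∀ x y, x ≠ y → dir x = dir y → G.Adj x y
  adj_iff_of_opposite : ∀ x y, dir y = dir x + 2 → (G.Adj x y ↔ rad x + rad y ≤ 2)
  adj_iff_of_next : ∀ x y, dir y = dir x + 1 → (G.Adj x y ↔ rad x ^ 2 + rad y ^ 2 ≤ 4)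
  exists_cycle : ∀ x, ∃ y z w, dir y = dir x + 1 ∧ dir z = dir x + 2 ∧ dir w = dir x + 3 ∧
    ¬ G.Adj x z ∧ ¬ G.Adj y w ∧ G.Adj x y ∧ G.Adj y z ∧ G.Adj z w ∧ G.Adj w x

/-- If three consecutive vertices of a four-cycle of disks are collinear, then some pair of
opposite disks meets. -/
theorem not_four_cycle_of_collinear {a b c d e : ℝ} (hac : 4 < (a - c) ^ 2)
    (hab : (a - b) ^ 2 ≤ 4) (hbc : (b - c) ^ 2 ≤ 4) (had : (a - d) ^ 2 + e ^ 2 ≤ 4)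
    (hcd : (c - d) ^ 2 + e ^ 2 ≤ 4) (hbd : 4 < (b - d) ^ 2 + e ^ 2) : False := by
  wlog h : a ≤ c generalizing a c
  · exact this (by linarith [sq_abs (a - c), sub_sq_comm a c]) (by linarith [sub_sq_comm c b])
      (by linarith [sub_sq_comm a b]) hcd had (by linarith)
  have h1 : b - a ≤ 2 := by nlinarith
  have h2 : c - b ≤ 2 := by nlinarith
  have h3 : 2 < c - a := by nlinarith
  -- Here `b` lies strictly between `a` and `c`. The squared distance to the fourth center is convex
  -- along the line and at most 4 at `a` and `c`, hence at most 4 at `b`.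
  nlinarith [mul_pos (show 0 < b - a by linarith) (show 0 < c - b by linarith)]

theorem mul_neg_of_far {a c : ℝ} (ha : a ^ 2 ≤ 4) (hc : c ^ 2 ≤ 4) (h : 4 < (a - c) ^ 2) :
    a * c < 0 := by
  by_contra! hn
  have ha' := abs_le_of_sq_le_sq' (show a ^ 2 ≤ 2 ^ 2 by linarith) (by norm_num)
  have hc' := abs_le_of_sq_le_sq' (show c ^ 2 ≤ 2 ^ 2 by linarith) (by norm_num)
  refine absurd h (not_lt.2 ?_)
  rw [show (4 : ℝ) = 2 ^ 2 by norm_num, sq_le_sq, abs_two, abs_le]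
  rcases mul_nonneg_iff.1 hn with h' | h' <;> constructor <;> linarith [h'.1, h'.2]

theorem not_three_on_axis {u v : Fin 4 → ℝ}
    (hadj : ∀ i, (u i - u (i + 1)) ^ 2 + (v i - v (i + 1)) ^ 2 ≤ 4)
    (hfar : ∀ i, 4 < (u i - u (i + 2)) ^ 2 + (v i - v (i + 2)) ^ 2) (i : Fin 4)
    (h0 : v i = 0) (h1 : v (i + 1) = 0) (h2 : v (i + 2) = 0) : False := by
  have e3 : i + 2 + 1 = i + 3 := by omega
  have e4 : i + 3 + 1 = i := by omega
  have e5 : i + 1 + 1 = i + 2 := by omega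
  have e6 : i + 1 + 2 = i + 3 := by omega
  have a1 := hadj i
  have a2 := hadj (i + 1)
  have a3 := hadj (i + 2)
  have a4 := hadj (i + 3)
  have f1 := hfar i
  have f2 := hfar (i + 1)
  rw [e5] at a2; rw [e3] at a3; rw [e4] at a4; rw [e6] at f2
  rw [h0, h1] at a1; rw [h1, h2] at a2; rw [h2] at a3; rw [h0] at a4
  rw [h0, h2] at f1; rw [h1] at f2
  exact not_four_cycle_of_collinear (a := u i) (b := u (i + 1)) (c := u (i + 2))
    (d := u (i + 3)) (e := v (i + 3)) (by linarith) (by linarith) (by linarith)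
    (by linarith [sub_sq_comm (u i) (u (i + 3))]) (by linarith) (by linarith)

/-- The four vertices of an induced four-cycle of unit disks centered on the axes alternate
between the axes, and opposite ones lie on different sides of the origin. -/
theorem four_cycle_position {u v : Fin 4 → ℝ} (hax : ∀ i, v i = 0 ∨ u i = 0)
    (hadj : ∀ i, (u i - u (i + 1)) ^ 2 + (v i - v (i + 1)) ^ 2 ≤ 4)
    (hfar : ∀ i, 4 < (u i - u (i + 2)) ^ 2 + (v i - v (i + 2)) ^ 2) :
    (v 0 = 0 ∧ v 2 = 0 ∧ u 1 = 0 ∧ u 3 = 0 ∧ u 0 * u 2 < 0 ∧ v 1 * v 3 < 0) ∨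
    (u 0 = 0 ∧ u 2 = 0 ∧ v 1 = 0 ∧ v 3 = 0 ∧ v 0 * v 2 < 0 ∧ u 1 * u 3 < 0) := by
  have tri := not_three_on_axis hadj hfar
  have tri' := not_three_on_axis (u := v) (v := u) (fun i => by linarith [hadj i])
    (fun i => by linarith [hfar i])
  have a0 := hadj 0
  have a1 := hadj 1
  have a2 := hadj 2
  have a3 := hadj 3
  have f0 := hfar 0
  have f1 := hfar 1
  simp only [Fin.isValue, Fin.reduceAdd, zero_add] at a0 a1 a2 a3 f0 f1
  rcases hax 0 with h0 | h0 <;> rcases hax 1 with h1 | h1 <;> rcases hax 2 with h2 | h2 <;>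
    rcases hax 3 with h3 | h3
  all_goals first
    | exact (tri 0 h0 h1 h2).elim
    | exact (tri 1 h1 h2 h3).elim
    | exact (tri 2 h2 h3 h0).elim
    | exact (tri 3 h3 h0 h1).elim
    | exact (tri' 0 h0 h1 h2).elim
    | exact (tri' 1 h1 h2 h3).elim
    | exact (tri' 2 h2 h3 h0).elim
    | exact (tri' 3 h3 h0 h1).elim
    | skip
  all_goals
    simp only [h0, h1, h2, h3, sub_zero, zero_sub, even_two, Even.neg_pow, sub_self, ne_eq,
      OfNat.ofNat_ne_zero, not_false_eq_true, zero_pow, add_zero, zero_add] at a0 a1 a2 a3 f0 f1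
  -- Two consecutive centers on each axis: the two diagonals and the two sides joining the axes have
  -- the same sum of squares, which would be above 8 and at most 8.
  · exfalso; linarith
  · left
    refine ⟨h0, h2, h1, h3, mul_neg_of_far ?_ ?_ f0, mul_neg_of_far ?_ ?_ f1⟩ <;>
      linarith [sq_nonneg (u 0), sq_nonneg (u 2), sq_nonneg (v 1), sq_nonneg (v 3)]
  · exfalso; linarith
  · exfalso; linarith
  · right
    refine ⟨h0, h2, h1, h3, mul_neg_of_far ?_ ?_ f0, mul_neg_of_far ?_ ?_ f1⟩ <;>
      linarith [sq_nonneg (v 0), sq_nonneg (v 2), sq_nonneg (u 1), sq_nonneg (u 3)]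
  · exfalso; linarith

/-- Source of the bound √3: one of the two cycle neighbours of a vertex has squared norm above 1,
and across perpendicular axes adjacent squared norms sum to at most 4. -/
theorem one_lt_sq_or_of_far {a c : ℝ} (h : 4 < (a - c) ^ 2) : 1 < a ^ 2 ∨ 1 < c ^ 2 := by
  by_contra! hn
  nlinarith [sq_nonneg (a + c)]

/-- The vertices of an induced four-cycle are not at the origin, and at distance less than
`√3` from it. -/
theorem four_cycle_norm_sq {u v : Fin 4 → ℝ} (hax : ∀ i, v i = 0 ∨ u i = 0)
    (hadj : ∀ i, (u i - u (i + 1)) ^ 2 + (v i - v (i + 1)) ^ 2 ≤ 4)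
    (hfar : ∀ i, 4 < (u i - u (i + 2)) ^ 2 + (v i - v (i + 2)) ^ 2) (i : Fin 4) :
    0 < u i ^ 2 + v i ^ 2 ∧ u i ^ 2 + v i ^ 2 < 3 := by
  have h := four_cycle_position hax hadj hfar
  have a0 := hadj 0
  have a1 := hadj 1
  have a2 := hadj 2
  have a3 := hadj 3
  have f0 := hfar 0
  have f1 := hfar 1
  simp only [Fin.isValue, Fin.reduceAdd, zero_add] at a0 a1 a2 a3 f0 f1
  rcases h with ⟨h0, h2, h1, h3, hu, hv⟩ | ⟨h0, h2, h1, h3, hu, hv⟩ <;>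
    simp only [h0, h1, h2, h3, sub_zero, zero_sub, even_two, Even.neg_pow, sub_self, ne_eq,
      OfNat.ofNat_ne_zero, not_false_eq_true, zero_pow, add_zero, zero_add] at a0 a1 a2 a3 f0 f1
  all_goals
    have n0 := pow_pos (abs_pos.2 (left_ne_zero_of_mul hu.ne)) 2
    have n1 := pow_pos (abs_pos.2 (left_ne_zero_of_mul hv.ne)) 2
    have n2 := pow_pos (abs_pos.2 (right_ne_zero_of_mul hu.ne)) 2
    have n3 := pow_pos (abs_pos.2 (right_ne_zero_of_mul hv.ne)) 2
    rw [sq_abs] at n0 n1 n2 n3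
    fin_cases i <;>
    simp only [Fin.isValue, Fin.zero_eta, Fin.mk_one, Fin.reduceFinMk, h0, h1, h2, h3, ne_eq,
      OfNat.ofNat_ne_zero, not_false_eq_true, zero_pow, add_zero, zero_add] <;>
    refine ⟨‹_›, ?_⟩ <;>
    rcases one_lt_sq_or_of_far f0 with f0 | f0 <;>
    rcases one_lt_sq_or_of_far f1 with f1 | f1 <;> linarith

/-- Going around an induced four-cycle, the directions run through all four values, in one of
the two orientations. -/
theorem four_cycle_direction {u v : Fin 4 → ℝ} (hax : ∀ i, v i = 0 ∨ u i = 0)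
    (hadj : ∀ i, (u i - u (i + 1)) ^ 2 + (v i - v (i + 1)) ^ 2 ≤ 4)
    (hfar : ∀ i, 4 < (u i - u (i + 2)) ^ 2 + (v i - v (i + 2)) ^ 2) :
    (∀ i, direction (u (i + 1)) (v (i + 1)) = direction (u i) (v i) + 1) ∨
      (∀ i, direction (u (i + 1)) (v (i + 1)) = direction (u i) (v i) + 3) := by
  rw [Fin.forall_fin_succ, Fin.forall_fin_succ, Fin.forall_fin_two,
    Fin.forall_fin_succ, Fin.forall_fin_succ, Fin.forall_fin_two]
  rcases four_cycle_position hax hadj hfar with ⟨h0, h2, h1, h3, hu, hv⟩ | ⟨h0, h2, h1, h3, hv, hu⟩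
  all_goals
    have n1 := left_ne_zero_of_mul hv.ne
    have n3 := right_ne_zero_of_mul hv.ne
    rcases mul_neg_iff.1 hu with ⟨p0, p2⟩ | ⟨p0, p2⟩ <;>
    rcases mul_neg_iff.1 hv with ⟨p1, p3⟩ | ⟨p1, p3⟩ <;>
    simp [direction, h0, h1, h2, h3, p0, p1, p2, p3, n1, n3,
      not_lt.2 p0.le, not_lt.2 p1.le, not_lt.2 p2.le, not_lt.2 p3.le]

theorem direction_cases {u v : ℝ} (h : v = 0 ∨ u = 0) (h0 : 0 < u ^ 2 + v ^ 2) :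
    (direction u v = 0 ∧ 0 < u ∧ v = 0) ∨ (direction u v = 1 ∧ 0 < v ∧ u = 0) ∨
    (direction u v = 2 ∧ u < 0 ∧ v = 0) ∨ (direction u v = 3 ∧ v < 0 ∧ u = 0) := by
  unfold direction
  by_cases hv : v = 0
  · have hu : u ≠ 0 := by rintro rfl; simp [hv] at h0
    rcases hu.lt_or_gt with hu | hu
    · simp [hv, hu, hu.le]
    · simp [hv, hu]
  · have hu := h.resolve_left hv
    rcases (Ne.lt_or_gt hv) with hv' | hv'
    · simp [hv, hu, hv', hv'.le]
    · simp [hv, hu, hv']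

open SimpleGraph in
theorem PolarData.nonempty_of_isAPUD11 {V : Type*} {G : SimpleGraph V} (hG : IsAPUD11 G) :
    Nonempty (PolarData (G.induce (inducedC4Vertices G))) := by
  obtain ⟨u, v, hax, hadj⟩ : ∃ u v : V → ℝ, (∀ x, v x = 0 ∨ u x = 0) ∧
      ∀ x y, x ≠ y → (G.Adj x y ↔ (u x - u y) ^ 2 + (v x - v y) ^ 2 ≤ 4) := by
    obtain ⟨c, hax, hc⟩ := hG
    exact ⟨fun x => c x 0, fun x => c x 1, hax,
      fun x y h => by rw [hc x y h, closedBall_one_inter_nonempty_iff]⟩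
  have c1 : ∀ i : Fin 4, (cycleGraph 4).Adj i (i + 1) := by decide
  have c2 : ∀ i : Fin 4, ¬ (cycleGraph 4).Adj i (i + 2) := by decide
  have hne : ∀ i : Fin 4, i ≠ i + 2 := by decide
  have e1 : ∀ (f : cycleGraph 4 ↪g G) i, (u (f i) - u (f (i + 1))) ^ 2 +
      (v (f i) - v (f (i + 1))) ^ 2 ≤ 4 := fun f i => by
    have := f.map_adj_iff.2 (c1 i)
    rwa [hadj _ _ this.ne] at this
  have e2 : ∀ (f : cycleGraph 4 ↪g G) i, 4 < (u (f i) - u (f (i + 2))) ^ 2 +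
      (v (f i) - v (f (i + 2))) ^ 2 := fun f i => by
    have := mt f.map_adj_iff.1 (c2 i)
    rwa [hadj _ _ (f.injective.ne (hne i)), not_le] at this
  have hnorm : ∀ x ∈ inducedC4Vertices G, 0 < u x ^ 2 + v x ^ 2 ∧ u x ^ 2 + v x ^ 2 < 3 := by
    rintro _ ⟨f, i, rfl⟩
    exact four_cycle_norm_sq (fun i => hax (f i)) (e1 f) (e2 f) i
  have hcas := fun x : inducedC4Vertices G => direction_cases (hax x) (hnorm x x.2).1
  have habs : ∀ x, (|u x| + |v x|) ^ 2 = u x ^ 2 + v x ^ 2 := fun x => by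
    rcases hax x with h | h <;> simp [h]
  -- One coordinate vanishes, so |u| + |v| is the distance to the origin.
  refine ⟨⟨fun x => direction (u x) (v x), fun x => |u x| + |v x|, fun x => ?_, fun x => ?_,
    fun x y hxy h => ?_, fun x y h => ?_, fun x y h => ?_, ?_⟩⟩
  · have := hnorm x x.2
    rw [← habs] at this
    exact lt_of_le_of_ne (by positivity) (by rintro h; simp [← h] at this)
  · rw [habs]
    exact (hnorm x x.2).2
  · have hxy' : (x : V) ≠ y := fun h => hxy (Subtype.ext h)
    have hx := (hnorm x x.2).2
    have hy := (hnorm y y.2).2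
    rw [comap_adj, Function.Embedding.subtype_apply, Function.Embedding.subtype_apply,
      hadj _ _ hxy']
    rcases hcas x with ⟨dx, sx, zx⟩ | ⟨dx, sx, zx⟩ | ⟨dx, sx, zx⟩ | ⟨dx, sx, zx⟩ <;>
    rcases hcas y with ⟨dy, sy, zy⟩ | ⟨dy, sy, zy⟩ | ⟨dy, sy, zy⟩ | ⟨dy, sy, zy⟩ <;>
    first
    | (exfalso; rw [dx, dy] at h; revert h; decide)
    | (rw [zx] at hx ⊢; rw [zy] at hy ⊢; nlinarith [mul_pos sx sy])
    | (rw [zx] at hx ⊢; rw [zy] at hy ⊢; nlinarith [mul_pos_of_neg_of_neg sx sy])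
  · have hxy' : (x : V) ≠ y := by
      rintro h'; rw [h'] at h; exact absurd h (hne _)
    rw [comap_adj, Function.Embedding.subtype_apply, Function.Embedding.subtype_apply,
      hadj _ _ hxy']
    rcases hcas x with ⟨dx, sx, zx⟩ | ⟨dx, sx, zx⟩ | ⟨dx, sx, zx⟩ | ⟨dx, sx, zx⟩ <;>
    rcases hcas y with ⟨dy, sy, zy⟩ | ⟨dy, sy, zy⟩ | ⟨dy, sy, zy⟩ | ⟨dy, sy, zy⟩ <;>
    first
    | (exfalso; rw [dx, dy] at h; revert h; decide)
    | (rw [zx, zy, abs_zero]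
       simp only [abs_of_pos, abs_of_neg, sx, sy]
       constructor <;> intro h' <;> nlinarith)
  · have hxy' : (x : V) ≠ y := by
      rintro h'; rw [h'] at h; revert h; generalize direction (u y) (v y) = d; decide +revert
    rw [comap_adj, Function.Embedding.subtype_apply, Function.Embedding.subtype_apply,
      hadj _ _ hxy', habs, habs]
    rcases hcas x with ⟨dx, sx, zx⟩ | ⟨dx, sx, zx⟩ | ⟨dx, sx, zx⟩ | ⟨dx, sx, zx⟩ <;>
    rcases hcas y with ⟨dy, sy, zy⟩ | ⟨dy, sy, zy⟩ | ⟨dy, sy, zy⟩ | ⟨dy, sy, zy⟩ <;>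
    first
    | (exfalso; rw [dx, dy] at h; revert h; decide)
    | (rw [zx, zy]; ring_nf)
  · rintro ⟨_, f, i, rfl⟩
    have i4 : i + 3 + 1 = i := by omega
    have i3 : i + 2 + 1 = i + 3 := by omega
    have i2 : i + 1 + 1 = i + 2 := by omega
    have i5 : i + 1 + 2 = i + 3 := by omega
    have d2 : ∀ d : Fin 4, d + 1 + 1 = d + 2 := by decide
    have d3 : ∀ d : Fin 4, d + 1 + 1 + 1 = d + 3 := by decide
    have d2' : ∀ d : Fin 4, d + 3 + 3 = d + 2 := by decide
    have d3' : ∀ d : Fin 4, d + 3 + 3 + 3 = d + 1 := by decide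
    have k1 := f.map_adj_iff.2 (c1 i)
    have k2 := f.map_adj_iff.2 (c1 (i + 1))
    have k3 := f.map_adj_iff.2 (c1 (i + 2))
    have k4 := f.map_adj_iff.2 (c1 (i + 3))
    have l1 := mt f.map_adj_iff.1 (c2 i)
    have l2 := mt f.map_adj_iff.1 (c2 (i + 1))
    rw [i2] at k2; rw [i3] at k3; rw [i4] at k4; rw [i5] at l2
    rcases four_cycle_direction (fun i => hax (f i)) (e1 f) (e2 f) with h | h
    · have h1 := h i
      have h2 := h (i + 1)
      have h3 := h (i + 2)
      rw [i2, h1] at h2; rw [i3, h2] at h3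
      refine ⟨⟨f (i + 1), f, _, rfl⟩, ⟨f (i + 2), f, _, rfl⟩, ⟨f (i + 3), f, _, rfl⟩,
        h1, h2.trans (d2 _), h3.trans (d3 _), l1, l2, k1, k2, k3, k4⟩
    -- The directions run the other way round, so the cycle is read backwards.
    · have h1 := h i
      have h2 := h (i + 1)
      have h3 := h (i + 2)
      rw [i2, h1] at h2; rw [i3, h2] at h3
      refine ⟨⟨f (i + 3), f, _, rfl⟩, ⟨f (i + 2), f, _, rfl⟩, ⟨f (i + 1), f, _, rfl⟩,
        h3.trans (d3' _), h2.trans (d2' _), h1, l1, fun h => l2 h.symm, k4.symm, k3.symm,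
        k2.symm, k1.symm⟩

end APUD

/-! ### Subdivisions glued from paths, and the lattice diamond as host. -/

namespace APUD
open SimpleGraph

/-- The walk `w` is an induced path of `K` with vertex set `D`. -/
def TracesPath {U : Type*} (K : SimpleGraph U) (D : Set U) {a b : U} (w : K.Walk a b) : Prop :=
  w.IsPath ∧ (∀ x, x ∈ w.support ↔ x ∈ D) ∧
    ∀ x y, K.Adj x y → x ∈ D → y ∈ D → s(x, y) ∈ w.edges

theorem TracesPath.reverse {U : Type*} {K : SimpleGraph U} {D : Set U} {a b : U}
    {w : K.Walk a b} (h : TracesPath K D w) : TracesPath K D w.reverse :=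
  ⟨h.1.reverse, by simpa using h.2.1, by simpa using h.2.2⟩

theorem exists_walk_of_sequence {U : Type*} {K : SimpleGraph U} (f : ℕ → U) (n : ℕ)
    (hadj : ∀ k < n, K.Adj (f k) (f (k + 1))) :
    ∃ w : K.Walk (f 0) (f n), (∀ x, x ∈ w.support ↔ ∃ k ≤ n, x = f k) ∧
      (∀ k < n, s(f k, f (k + 1)) ∈ w.edges) ∧ (Set.InjOn f (Set.Iic n) → w.IsPath) := by
  induction n with
  | zero => exact ⟨.nil, by simp, by simp, by simp⟩
  | succ n ih =>
    obtain ⟨w, hs, he, hp⟩ := ih fun k hk => hadj k (by omega)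
    refine ⟨w.concat (hadj n (by omega)), fun x => ?_, fun k hk => ?_, fun hinj => ?_⟩
    · rw [Walk.support_concat, List.mem_append, hs, List.mem_singleton]
      constructor
      · rintro (⟨k, hk, rfl⟩ | rfl)
        · exact ⟨k, by omega, rfl⟩
        · exact ⟨_, le_rfl, rfl⟩
      · rintro ⟨k, hk, rfl⟩
        rcases hk.lt_or_eq with hk | rfl
        · exact Or.inl ⟨k, by omega, rfl⟩
        · exact Or.inr rfl
    · rw [Walk.edges_concat, List.concat_eq_append, List.mem_append, List.mem_singleton]
      rcases Nat.lt_succ_iff_lt_or_eq.1 hk with hk | rfl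
      · exact Or.inl (he k hk)
      · exact Or.inr rfl
    · refine (hp (hinj.mono (Set.Iic_subset_Iic.2 (by omega)))).concat ?_ _
      rw [hs]
      rintro ⟨k, hk, h⟩
      have := hinj (Set.mem_Iic.2 le_rfl) (Set.mem_Iic.2 (by omega)) h
      omega

/-- A graph glued from paths, one for each edge of `H`, is a subdivision of `H`. -/
theorem Subdivision.nonempty_of_paths {W U ι : Type*} {H : SimpleGraph W} {K : SimpleGraph U}
    (branch : W ↪ U) (src tgt : ι → W) (D : ι → Set U)
    (hH : ∀ a b, H.Adj a b ↔ ∃ i, s(a, b) = s(src i, tgt i))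
    (hinj : ∀ i j, s(src i, tgt i) = s(src j, tgt j) → i = j)
    (hD : ∀ i, ∃ w : K.Walk (branch (src i)) (branch (tgt i)), TracesPath K (D i) w)
    (hbranch : ∀ i c, branch c ∈ D i → c = src i ∨ c = tgt i)
    (hdisj : ∀ i j, i ≠ j → ∀ x ∈ D i, x ∈ D j →
      ∃ e, (e = src i ∨ e = tgt i) ∧ (e = src j ∨ e = tgt j) ∧ x = branch e)
    (hvertex : ∀ x, ∃ i, x ∈ D i)
    (hedge : ∀ x y, K.Adj x y → ∃ i, x ∈ D i ∧ y ∈ D i) : Nonempty (Subdivision H K) := by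
  classical
  have hwalk : ∀ {a b : W} (_ : H.Adj a b), ∃ w : K.Walk (branch a) (branch b),
      ∃ i, s(a, b) = s(src i, tgt i) ∧ TracesPath K (D i) w := by
    intro a b h
    obtain ⟨i, hi⟩ := (hH a b).1 h
    obtain ⟨w, hw⟩ := hD i
    rcases Sym2.eq_iff.1 hi with ⟨rfl, rfl⟩ | ⟨rfl, rfl⟩
    · exact ⟨w, i, hi, hw⟩
    · exact ⟨w.reverse, i, hi, hw.reverse⟩
  obtain ⟨path, hsymm, hpath⟩ : ∃ path : ∀ {a b : W}, H.Adj a b → K.Walk (branch a) (branch b),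
      (∀ {a b : W} (h : H.Adj a b), path h.symm = (path h).reverse) ∧
      ∀ {a b : W} (h : H.Adj a b), ∃ i, s(a, b) = s(src i, tgt i) ∧
        TracesPath K (D i) (path h) := by
    choose w hw using @hwalk
    -- A well-order of the vertices orients every edge; the walk chosen for that orientation is
    -- reversed for the other, which forces `path h.symm = (path h).reverse`.
    refine ⟨fun {a b} h => if WellOrderingRel a b then w h else (w h.symm).reverse,
      fun {a b} h => ?_, fun {a b} h => ?_⟩
    · rcases trichotomous_of WellOrderingRel a b with hab | hab | hab
      · simp [hab, asymm_of WellOrderingRel hab]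
      · exact (h.ne hab).elim
      · simp [hab, asymm_of WellOrderingRel hab]
    · by_cases hab : WellOrderingRel a b
      · simpa [hab] using hw h
      · obtain ⟨i, hi, ht⟩ := hw h.symm
        simp only [hab, if_false]
        exact ⟨i, Sym2.eq_swap.trans hi, ht.reverse⟩
  have hmem : ∀ {a b : W} (i : ι), s(a, b) = s(src i, tgt i) → ∀ e, e = src i ∨ e = tgt i →
      e ∈ s(a, b) := fun i hi e he => by rwa [hi, Sym2.mem_iff]
  have hof : ∀ i, ∃ h : H.Adj (src i) (tgt i), TracesPath K (D i) (path h) := fun i => by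
    have h := (hH _ _).2 ⟨i, rfl⟩
    obtain ⟨j, hj, ht⟩ := hpath h
    obtain rfl := hinj i j hj
    exact ⟨h, ht⟩
  refine ⟨⟨branch, path, fun h => ?_, hsymm, fun {a b} h c hc => ?_,
    fun {a b c d} h h' hne x hx hx' => ?_, fun x => ?_, fun e => ?_⟩⟩
  · obtain ⟨i, -, ht⟩ := hpath h
    exact ht.1
  · obtain ⟨i, hi, ht⟩ := hpath h
    exact Sym2.mem_iff.1 (hmem i hi c (hbranch i c ((ht.2.1 _).1 hc)))
  · obtain ⟨i, hi, ht⟩ := hpath h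
    obtain ⟨j, hj, ht'⟩ := hpath h'
    have hij : i ≠ j := by
      rintro rfl
      exact hne (hi.trans hj.symm)
    obtain ⟨e, he, he', hxe⟩ := hdisj i j hij x ((ht.2.1 _).1 hx) ((ht'.2.1 _).1 hx')
    exact ⟨e, hmem i hi e he, hmem j hj e he', hxe⟩
  · obtain ⟨i, hi⟩ := hvertex x
    obtain ⟨h, ht⟩ := hof i
    exact Or.inr ⟨_, _, h, (ht.2.1 _).2 hi⟩
  · induction e with
    | h x y =>
      intro hxy
      obtain ⟨i, hx, hy⟩ := hedge x y hxy
      obtain ⟨h, ht⟩ := hof i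
      exact ⟨_, _, h, ht.2.2 x y hxy hx hy⟩

/-- The lattice points of the diamond `|x| + |y| = M`, and a further point next to each of its
four corners. -/
@[ext]
structure Diamond (M : ℕ) where
  x : ℤ
  y : ℤ
  mem : x.natAbs + y.natAbs = M ∨ (x.natAbs = M + 1 ∧ y = 1) ∨ (x = 1 ∧ y.natAbs = M + 1)

/-- Diagonal steps between the points of the diamond: a cycle of length `4 * M` with a pendant
vertex at each corner. -/
def diamondGraph (M : ℕ) : SimpleGraph (Diamond M) where
  Adj p q := (p.x - q.x).natAbs = 1 ∧ (p.y - q.y).natAbs = 1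
  symm := ⟨fun p q h => by omega⟩
  loopless := ⟨fun p h => by omega⟩

namespace Diamond

variable {M : ℕ}

/-- How far a point reaches in one of the four directions. -/
def height (p : Diamond M) : Fin 4 → ℤ
  | 0 => p.x
  | 1 => p.y
  | 2 => -p.x
  | 3 => -p.y

/-- The corners of the diamond and the pendant points. -/
def branch (M : ℕ) : Fin 4 ⊕ Fin 4 → Diamond M
  | .inl 0 => ⟨M, 0, by omega⟩
  | .inl 1 => ⟨0, M, by omega⟩
  | .inl 2 => ⟨-M, 0, by omega⟩
  | .inl 3 => ⟨0, -M, by omega⟩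
  | .inr 0 => ⟨M + 1, 1, by omega⟩
  | .inr 1 => ⟨1, M + 1, by omega⟩
  | .inr 2 => ⟨-(M + 1), 1, by omega⟩
  | .inr 3 => ⟨1, -(M + 1), by omega⟩

/-- The sides of the diamond and the pendant edges. -/
def side (M : ℕ) : Fin 4 ⊕ Fin 4 → Set (Diamond M)
  | .inl i => {p | p.x.natAbs + p.y.natAbs = M ∧ 0 ≤ p.height i ∧ 0 ≤ p.height (i + 1)}
  | .inr i => {p | (M : ℤ) ≤ p.height i}

def sideSource : Fin 4 ⊕ Fin 4 → Fin 4 ⊕ Fin 4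
  | .inl i => .inl i
  | .inr i => .inl i

def sideTarget : Fin 4 ⊕ Fin 4 → Fin 4 ⊕ Fin 4
  | .inl i => .inl (i + 1)
  | .inr i => .inr i

/-- The points of a side of the diamond in order. -/
def sidePoint (M : ℕ) (k : ℕ) : Fin 4 → Diamond M
  | 0 => ⟨M - min k M, min k M, by omega⟩
  | 1 => ⟨- min k M, M - min k M, by omega⟩
  | 2 => ⟨- (M - min k M), - min k M, by omega⟩
  | 3 => ⟨min k M, - (M - min k M), by omega⟩

theorem fin_four_cases (i : Fin 4) : i = 0 ∨ i = 1 ∨ i = 2 ∨ i = 3 := by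
  decide +revert

theorem branch_injective (hM : 2 ≤ M) : Function.Injective (branch M) := by
  intro a b h
  rcases a with a | a <;> rcases b with b | b <;>
    rcases fin_four_cases a with rfl | rfl | rfl | rfl <;>
    rcases fin_four_cases b with rfl | rfl | rfl | rfl <;>
    first
    | rfl
    | (exfalso
       simp only [branch, Diamond.ext_iff] at h
       omega)

theorem exists_tracesPath_side (i : Fin 4) :
    ∃ w : (diamondGraph M).Walk (branch M (.inl i)) (branch M (.inl (i + 1))),
      TracesPath (diamondGraph M) (side M (.inl i)) w := by
  have h0 : sidePoint M 0 i = branch M (.inl i) := by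
    rcases fin_four_cases i with rfl | rfl | rfl | rfl <;>
      simp [sidePoint, branch]
  have h1 : sidePoint M M i = branch M (.inl (i + 1)) := by
    rcases fin_four_cases i with rfl | rfl | rfl | rfl <;>
      simp [sidePoint, branch]
  rw [← h0, ← h1]
  obtain ⟨w, hs, he, hp⟩ := exists_walk_of_sequence (K := diamondGraph M)
    (fun k => sidePoint M k i) M (by
      intro k hk
      rcases fin_four_cases i with rfl | rfl | rfl | rfl <;>
        simp only [sidePoint, diamondGraph] <;> omega)
  have hD : ∀ p, p ∈ side M (.inl i) ↔ ∃ k ≤ M, p = sidePoint M k i := by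
    intro p
    constructor
    · rintro ⟨h, h', h''⟩
      rcases fin_four_cases i with rfl | rfl | rfl | rfl <;>
        simp only [height, Fin.isValue, Fin.reduceAdd, zero_add] at h' h''
      · exact ⟨p.y.natAbs, by omega, by ext <;> simp only [sidePoint] <;> omega⟩
      · exact ⟨p.x.natAbs, by omega, by ext <;> simp only [sidePoint] <;> omega⟩
      · exact ⟨p.y.natAbs, by omega, by ext <;> simp only [sidePoint] <;> omega⟩
      · exact ⟨p.x.natAbs, by omega, by ext <;> simp only [sidePoint] <;> omega⟩
    · rintro ⟨k, hk, rfl⟩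
      rcases fin_four_cases i with rfl | rfl | rfl | rfl <;>
        simp only [side, sidePoint, height, Fin.isValue, Fin.reduceAdd, zero_add,
          Set.mem_ofPred_eq] <;> omega
  refine ⟨w, hp fun k hk l hl hkl => ?_, fun p => (hs p).trans (hD p).symm,
    fun p q hpq hpD hqD => ?_⟩
  · rw [Set.mem_Iic] at hk hl
    rcases fin_four_cases i with rfl | rfl | rfl | rfl <;>
      simp only [sidePoint, Diamond.ext_iff] at hkl <;> omega
  · obtain ⟨k, hk, rfl⟩ := (hD p).1 hpD
    obtain ⟨l, hl, rfl⟩ := (hD q).1 hqD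
    have hkl : l = k + 1 ∨ k = l + 1 := by
      rcases fin_four_cases i with rfl | rfl | rfl | rfl <;>
        simp only [sidePoint, diamondGraph] at hpq <;> omega
    rcases hkl with rfl | rfl
    · exact he k (by omega)
    · rw [Sym2.eq_swap]
      exact he l (by omega)

/-- The bound `2 ≤ M` keeps the small coordinate 1 of a pendant point below `M`; for `M = 1` the
pendant points (2, 1) and (1, 2) would be adjacent. -/
theorem exists_tracesPath_pendant (hM : 2 ≤ M) (i : Fin 4) :
    ∃ w : (diamondGraph M).Walk (branch M (.inl i)) (branch M (.inr i)),
      TracesPath (diamondGraph M) (side M (.inr i)) w := by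
  have hadj : (diamondGraph M).Adj (branch M (.inl i)) (branch M (.inr i)) := by
    rcases fin_four_cases i with rfl | rfl | rfl | rfl <;>
      simp only [branch, diamondGraph] <;> omega
  have hD : ∀ p, p ∈ side M (.inr i) ↔ p = branch M (.inl i) ∨ p = branch M (.inr i) := by
    intro p
    have := p.mem
    rcases fin_four_cases i with rfl | rfl | rfl | rfl <;>
      simp only [side, height, branch, Diamond.ext_iff, Set.mem_ofPred_eq] <;> omega
  refine ⟨.cons hadj .nil, ?_, fun p => ?_, fun p q hpq hp hq => ?_⟩
  · simp [hadj.ne]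
  · simp [hD]
  · rw [hD] at hp hq
    rcases hp with rfl | rfl <;> rcases hq with rfl | rfl
    · exact (hpq.ne rfl).elim
    · simp
    · simp [Sym2.eq_swap]
    · exact (hpq.ne rfl).elim

theorem cycleWithFourRays_adj_iff (a b : Fin 4 ⊕ Fin 4) : cycleWithFourRays.Adj a b ↔
    ∃ e, s(a, b) = s(sideSource e, sideTarget e) := by
  have key : ∀ i j : Fin 4, (cycleGraph 4).Adj i j ↔ j = i + 1 ∨ i = j + 1 := by decide
  rcases a with i | i <;> rcases b with j | j <;>
    simp [cycleWithFourRays, sideSource, sideTarget, key]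
  · aesop
  · aesop
  · aesop

theorem side_inter_side (hM : 2 ≤ M) {i j : Fin 4} (hij : i ≠ j) {p : Diamond M}
    (hp : p ∈ side M (.inl i)) (hq : p ∈ side M (.inl j)) :
    (j = i + 1 ∨ i = j + 1) ∧ ∀ k, (k = i ∨ k = i + 1) → (k = j ∨ k = j + 1) →
      p = branch M (.inl k) := by
  obtain ⟨h, hi, hi'⟩ := hp
  obtain ⟨-, hj, hj'⟩ := hq
  -- Heights `i` and `i + 2` are negatives of each other, so both vanish and only the corner between
  -- them remains. On two opposite sides at once all heights would vanish, as they do only at the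
  -- origin.
  have hb : ∀ i : Fin 4, 0 ≤ p.height i → 0 ≤ p.height (i + 1) → 0 ≤ p.height (i + 2) →
      p = branch M (.inl (i + 1)) := by
    intro i h1 h2 h3
    rcases fin_four_cases i with rfl | rfl | rfl | rfl <;>
      simp only [height, Fin.isValue, Fin.reduceAdd, zero_add] at h1 h2 h3 <;>
      simp only [branch, Fin.isValue, Fin.reduceAdd, zero_add] <;> ext <;> simp only <;> omega
  have ho : j ≠ i + 2 := by
    rintro rfl
    rcases fin_four_cases i with rfl | rfl | rfl | rfl <;>
      simp only [height, Fin.isValue, Fin.reduceAdd, zero_add] at hi hi' hj hj' <;> omega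
  have h2 : ∀ i : Fin 4, i + 1 + 1 = i + 2 := by decide
  have hor : j = i + 1 ∨ i = j + 1 := by omega
  refine ⟨hor, fun k hk hk' => ?_⟩
  rcases hor with rfl | rfl
  · obtain rfl : k = i + 1 := by omega
    exact hb i hi hi' (h2 i ▸ hj')
  · obtain rfl : k = j + 1 := by omega
    exact hb j hj hj' (h2 j ▸ hi')

theorem side_inter_pendant (hM : 2 ≤ M) {i j : Fin 4} {p : Diamond M}
    (hp : p ∈ side M (.inl i)) (hq : p ∈ side M (.inr j)) :
    (j = i ∨ j = i + 1) ∧ p = branch M (.inl j) := by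
  obtain ⟨h, hi, hi'⟩ := hp
  replace hq : (M : ℤ) ≤ p.height j := hq
  constructor
  · rcases fin_four_cases i with rfl | rfl | rfl | rfl <;>
      rcases fin_four_cases j with rfl | rfl | rfl | rfl <;>
      first
      | decide
      | (exfalso
         simp only [height, Fin.isValue, Fin.reduceAdd, zero_add] at hi hi' hq
         omega)
  · rcases fin_four_cases j with rfl | rfl | rfl | rfl <;> simp only [height] at hq <;>
      simp only [branch] <;> ext <;> simp only <;> omega

theorem pendant_disjoint (hM : 2 ≤ M) {i j : Fin 4} (hij : i ≠ j) {p : Diamond M}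
    (hp : p ∈ side M (.inr i)) (hq : p ∈ side M (.inr j)) : False := by
  have := p.mem
  replace hp : (M : ℤ) ≤ p.height i := hp
  replace hq : (M : ℤ) ≤ p.height j := hq
  rcases fin_four_cases i with rfl | rfl | rfl | rfl <;>
    rcases fin_four_cases j with rfl | rfl | rfl | rfl <;>
    first
    | exact hij rfl
    | (simp only [height] at hp hq
       omega)

theorem nonempty_subdivision (hM : 2 ≤ M) :
    Nonempty (Subdivision cycleWithFourRays (diamondGraph M)) := by
  refine Subdivision.nonempty_of_paths ⟨branch M, branch_injective hM⟩ sideSource sideTarget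
    (side M) cycleWithFourRays_adj_iff ?_ ?_ ?_ ?_ ?_ ?_
  · rintro (i | i) (j | j) <;> simp [sideSource, sideTarget]
    omega
  · rintro (i | i)
    · exact exists_tracesPath_side i
    · exact exists_tracesPath_pendant hM i
  · rintro (i | i) (c | c) <;> rcases fin_four_cases i with rfl | rfl | rfl | rfl <;>
      rcases fin_four_cases c with rfl | rfl | rfl | rfl <;>
      simp [side, branch, height, sideSource, sideTarget] <;> omega
  · intro i j hij p hp hq
    rcases i with i | i <;> rcases j with j | j
    · have hij' : i ≠ j := fun h => hij (congrArg _ h)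
      obtain ⟨h | h, hk⟩ := side_inter_side hM hij' hp hq
      · exact ⟨.inl j, by simp [sideSource, sideTarget, h], by simp [sideSource],
          hk j (Or.inr h) (Or.inl rfl)⟩
      · exact ⟨.inl i, by simp [sideSource], by simp [sideSource, sideTarget, h],
          hk i (Or.inl rfl) (Or.inr h)⟩
    · obtain ⟨h, hk⟩ := side_inter_pendant hM hp hq
      exact ⟨.inl j, by simpa [sideSource, sideTarget] using h, by simp [sideSource], hk⟩
    · obtain ⟨h, hk⟩ := side_inter_pendant hM hq hp
      exact ⟨.inl i, by simp [sideSource], by simpa [sideSource, sideTarget] using h, hk⟩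
    · exact (pendant_disjoint hM (fun h => hij (congrArg _ h)) hp hq).elim
  · intro p
    rcases p.mem with h | h | h
    · rcases le_total 0 p.x with hx | hx <;> rcases le_total 0 p.y with hy | hy
      · exact ⟨.inl 0, h, hx, hy⟩
      · exact ⟨.inl 3, h, neg_nonneg.2 hy, hx⟩
      · exact ⟨.inl 1, h, hy, neg_nonneg.2 hx⟩
      · exact ⟨.inl 2, h, neg_nonneg.2 hx, neg_nonneg.2 hy⟩
    · rcases le_total 0 p.x with hx | hx
      · exact ⟨.inr 0, show _ ≤ p.x by omega⟩
      · exact ⟨.inr 2, show _ ≤ -p.x by omega⟩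
    · rcases le_total 0 p.y with hy | hy
      · exact ⟨.inr 1, show _ ≤ p.y by omega⟩
      · exact ⟨.inr 3, show _ ≤ -p.y by omega⟩
  · rintro p q ⟨hx, hy⟩
    have hp := p.mem
    have hq := q.mem
    by_cases h : p.x.natAbs + p.y.natAbs = M ∧ q.x.natAbs + q.y.natAbs = M
    -- Coordinates of adjacent points differ by 1, so the sign of their sum puts both weakly on the
    -- same side of 0.
    · rcases lt_or_ge 0 (p.x + q.x) with sx | sx <;> rcases lt_or_ge 0 (p.y + q.y) with sy | sy
      · exact ⟨.inl 0, ⟨h.1, show 0 ≤ p.x by omega, show 0 ≤ p.y by omega⟩,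
          h.2, show 0 ≤ q.x by omega, show 0 ≤ q.y by omega⟩
      · exact ⟨.inl 3, ⟨h.1, show 0 ≤ -p.y by omega, show 0 ≤ p.x by omega⟩,
          h.2, show 0 ≤ -q.y by omega, show 0 ≤ q.x by omega⟩
      · exact ⟨.inl 1, ⟨h.1, show 0 ≤ p.y by omega, show 0 ≤ -p.x by omega⟩,
          h.2, show 0 ≤ q.y by omega, show 0 ≤ -q.x by omega⟩
      · exact ⟨.inl 2, ⟨h.1, show 0 ≤ -p.x by omega, show 0 ≤ -p.y by omega⟩,
          h.2, show 0 ≤ -q.x by omega, show 0 ≤ -q.y by omega⟩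
    · have : ((M : ℤ) ≤ p.x ∧ M ≤ q.x) ∨ ((M : ℤ) ≤ p.y ∧ M ≤ q.y) ∨
          ((M : ℤ) ≤ -p.x ∧ M ≤ -q.x) ∨ ((M : ℤ) ≤ -p.y ∧ M ≤ -q.y) := by omega
      rcases this with h | h | h | h
      · exact ⟨.inr 0, h⟩
      · exact ⟨.inr 1, h⟩
      · exact ⟨.inr 2, h⟩
      · exact ⟨.inr 3, h⟩

/-- The points of the diamond at distance at most `r` from the corner in direction `i`. -/
def ball (M r : ℕ) (i : Fin 4) : Set (Diamond M) :=
  {p | p.x.natAbs + p.y.natAbs = M ∧ (M : ℤ) - r ≤ p.height i}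

end Diamond

/-- A vertex set is connected if each of its points other than `c` has a neighbour in it of
smaller potential. -/
theorem induce_connected_of_potential {U : Type*} {K : SimpleGraph U} {S : Set U} (φ : U → ℕ)
    {c : U} (hc : c ∈ S) (h : ∀ p ∈ S, p ≠ c → ∃ q ∈ S, K.Adj p q ∧ φ q < φ p) :
    (K.induce S).Connected := by
  have key : ∀ n, ∀ p : S, φ p = n → (K.induce S).Reachable p ⟨c, hc⟩ := by
    intro n
    induction n using Nat.strong_induction_on with
    | _ n ih =>
      rintro p rfl
      by_cases hpc : (p : U) = c
      · obtain rfl : p = ⟨c, hc⟩ := Subtype.ext hpc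
        rfl
      · obtain ⟨q, hq, hadj, hlt⟩ := h p p.2 hpc
        exact (show (K.induce S).Adj p ⟨q, hq⟩ from hadj).reachable.trans (ih _ hlt ⟨q, hq⟩ rfl)
  exact (connected_iff_exists_forall_reachable _).2 ⟨⟨c, hc⟩, fun p => (key _ p rfl).symm⟩

/-! ### Balls around the corners and their intersections. -/

namespace Diamond

variable {M : ℕ}

theorem branch_mem_ball (r : ℕ) (i : Fin 4) : branch M (.inl i) ∈ ball M r i := by
  rcases fin_four_cases i with rfl | rfl | rfl | rfl <;> simp [branch, ball, height]

/-- From any point but the corner, a step along the diamond raises the height in direction `i` by 1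
and stays in the ball. -/
theorem ball_connected (r : ℕ) (i : Fin 4) : ((diamondGraph M).induce (ball M r i)).Connected := by
  refine induce_connected_of_potential (fun p => (M - p.height i).toNat) (branch_mem_ball r i) ?_
  rintro p ⟨hp, hr⟩ hne
  have step : ∀ x y : ℤ, x.natAbs + y.natAbs = M → x < M → ∃ y' : ℤ,
      (x + 1).natAbs + y'.natAbs = M ∧ (y - y').natAbs = 1 := by
    intro x y h hx
    rcases le_or_gt 0 y with hy | hy
    · exact ⟨M - (x + 1).natAbs, by omega, by omega⟩
    · exact ⟨(x + 1).natAbs - M, by omega, by omega⟩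
  have hlt : p.height i < M := by
    by_contra! h
    refine hne ?_
    rcases fin_four_cases i with rfl | rfl | rfl | rfl <;> simp only [height] at h <;>
      simp only [branch] <;> ext <;> simp only <;> omega
  rcases fin_four_cases i with rfl | rfl | rfl | rfl <;> simp only [height] at hr hlt
  · obtain ⟨t, ht, ht'⟩ := step p.x p.y hp hlt
    exact ⟨⟨p.x + 1, t, Or.inl ht⟩, ⟨ht, by simp only [height]; omega⟩,
      ⟨by simp only; omega, ht'⟩, by simp only [height]; omega⟩
  · obtain ⟨t, ht, ht'⟩ := step p.y p.x (by omega) hlt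
    exact ⟨⟨t, p.y + 1, by omega⟩, ⟨by simp only; omega, by simp only [height]; omega⟩,
      ⟨ht', by simp only; omega⟩, by simp only [height]; omega⟩
  · obtain ⟨t, ht, ht'⟩ := step (-p.x) p.y (by omega) hlt
    exact ⟨⟨p.x - 1, t, by omega⟩, ⟨by simp only; omega, by simp only [height]; omega⟩,
      ⟨by simp only; omega, ht'⟩, by simp only [height]; omega⟩
  · obtain ⟨t, ht, ht'⟩ := step (-p.y) p.x (by omega) hlt
    exact ⟨⟨t, p.y - 1, by omega⟩, ⟨by simp only; omega, by simp only [height]; omega⟩,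
      ⟨ht', by simp only; omega⟩, by simp only [height]; omega⟩

theorem ball_inter_same (r s : ℕ) (i : Fin 4) : (ball M r i ∩ ball M s i).Nonempty :=
  ⟨_, branch_mem_ball r i, branch_mem_ball s i⟩

theorem ball_inter_opposite (r s : ℕ) (i : Fin 4) :
    (ball M r i ∩ ball M s (i + 2)).Nonempty ↔ 2 * M ≤ r + s := by
  constructor
  · rintro ⟨p, ⟨hp, hr⟩, -, hs⟩
    rcases fin_four_cases i with rfl | rfl | rfl | rfl <;>
      simp only [height, Fin.isValue, Fin.reduceAdd, zero_add] at hr hs <;> omega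
  · intro h
    obtain ⟨x, y, hxy, hx, hx'⟩ : ∃ x y : ℤ, x.natAbs + y.natAbs = M ∧ (M : ℤ) - r ≤ x ∧
        (M : ℤ) - s ≤ -x :=
      -- The lowest height the first ball allows, cut off at the opposite corner.
      ⟨max (-(M : ℤ)) (M - r), M - (max (-(M : ℤ)) (M - r)).natAbs, by omega, by omega, by omega⟩
    rcases fin_four_cases i with rfl | rfl | rfl | rfl
    · exact ⟨⟨x, y, Or.inl hxy⟩, ⟨hxy, hx⟩, hxy, hx'⟩
    · exact ⟨⟨y, x, by omega⟩, ⟨by simp only; omega, hx⟩, by simp only; omega, hx'⟩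
    · exact ⟨⟨-x, y, by omega⟩, ⟨by simp only; omega, show _ ≤ - -x by omega⟩,
        by simp only; omega, hx'⟩
    · exact ⟨⟨y, -x, by omega⟩, ⟨by simp only; omega, show _ ≤ - -x by omega⟩,
        by simp only; omega, hx'⟩

/-- On the diamond two neighbouring heights sum to at most `M`, with equality on side `i`; the
witness lies there, `r` steps from the corner (at most `M`). -/
theorem ball_inter_next (r s : ℕ) (i : Fin 4) :
    (ball M r i ∩ ball M s (i + 1)).Nonempty ↔ M ≤ r + s := by
  constructor
  · rintro ⟨p, ⟨hp, hr⟩, -, hs⟩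
    rcases fin_four_cases i with rfl | rfl | rfl | rfl <;>
      simp only [height, Fin.isValue, Fin.reduceAdd, zero_add] at hr hs <;> omega
  · intro h
    refine ⟨sidePoint M (min r M) i, ⟨?_, ?_⟩, ?_, ?_⟩ <;>
    rcases fin_four_cases i with rfl | rfl | rfl | rfl <;>
      simp only [sidePoint, height, Fin.isValue, Fin.reduceAdd, zero_add] <;> omega

end Diamond

end APUD

/-! ### Reaches, their rounding, and the representation on the cycle with rays. -/

namespace APUD
open SimpleGraph

/-- Finitely many real radii can be scaled and rounded up to natural numbers without changing
which sums of two radii reach a given threshold. -/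
theorem exists_nat_radii {V : Type*} [Finite V] (ρ : V → ℝ) (hρ : ∀ x, 0 ≤ ρ x) :
    ∃ (K : ℕ) (r : V → ℕ), 0 < K ∧ ∀ x y, ∀ c : Fin 9,
      ((c : ℕ) * K ≤ r x + r y ↔ ((c : ℕ) : ℝ) ≤ ρ x + ρ y) := by
  have h : ∀ᶠ K : ℕ in Filter.atTop, 0 < K ∧ ∀ x y, ∀ c : Fin 9,
      ((c : ℕ) * K ≤ ⌈K * ρ x⌉₊ + ⌈K * ρ y⌉₊ ↔ ((c : ℕ) : ℝ) ≤ ρ x + ρ y) := by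
    refine (Filter.eventually_gt_atTop 0).and ?_
    simp only [Filter.eventually_all]
    intro x y c
    by_cases hc : ((c : ℕ) : ℝ) ≤ ρ x + ρ y
    · refine Filter.Eventually.of_forall fun K => iff_of_true ?_ hc
      have h1 := Nat.le_ceil (K * ρ x)
      have h2 := Nat.le_ceil (K * ρ y)
      have h3 := mul_le_mul_of_nonneg_right hc (Nat.cast_nonneg (α := ℝ) K)
      have : ((c : ℕ) : ℝ) * K ≤ ⌈K * ρ x⌉₊ + ⌈K * ρ y⌉₊ := by linarith
      exact_mod_cast this
    · have hpos : 0 < ((c : ℕ) : ℝ) - (ρ x + ρ y) := by linarith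
      -- Two roundings add less than 2 in all, which the missing amount scaled by `K` outweighs.
      have := (tendsto_natCast_atTop_atTop (R := ℝ)).eventually_ge_atTop
        (2 / (((c : ℕ) : ℝ) - (ρ x + ρ y)))
      filter_upwards [this] with K hK
      refine iff_of_false (not_le.2 ?_) hc
      rw [div_le_iff₀ hpos] at hK
      have h1 := Nat.ceil_lt_add_one (mul_nonneg (Nat.cast_nonneg (α := ℝ) K) (hρ x))
      have h2 := Nat.ceil_lt_add_one (mul_nonneg (Nat.cast_nonneg (α := ℝ) K) (hρ y))
      have : (⌈K * ρ x⌉₊ + ⌈K * ρ y⌉₊ : ℝ) < ((c : ℕ) : ℝ) * K := by linarith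
      exact_mod_cast this
  obtain ⟨K, hK, h⟩ := h.exists
  exact ⟨K, _, hK, h⟩

variable {V : Type*} {G : SimpleGraph V}

/-- On a circle of length `16`, how far the arc of a vertex reaches from its direction to both
sides. -/
noncomputable def PolarData.reach (P : PolarData G) (x : V) : ℝ :=
  -- For radii above 1, reach 4 − rad² encodes the threshold 4, and two such reaches stay below 8. A
  -- radius at most 1 meets every neighbouring direction; its reach is chosen so that with a radius
  -- s > 1 the sum is 8 + (2 − rad)² − s², at least 8 iff s ≤ 2 − rad.
  if P.rad x ≤ 1 then 4 + (2 - P.rad x) ^ 2 else 4 - P.rad x ^ 2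

theorem PolarData.reach_nonneg (P : PolarData G) (x : V) : 0 ≤ P.reach x := by
  unfold reach
  split_ifs
  · positivity
  · linarith [P.rad_sq_lt x]

theorem PolarData.rad_lt_two (P : PolarData G) (x : V) : P.rad x < 2 := by
  nlinarith [P.rad_sq_lt x]

theorem PolarData.four_le_reach_add_reach (P : PolarData G) (x y : V) :
    4 ≤ P.reach x + P.reach y ↔ P.rad x ^ 2 + P.rad y ^ 2 ≤ 4 := by
  have hx := P.rad_pos x
  have hy := P.rad_pos y
  have hx' := P.rad_sq_lt x
  have hy' := P.rad_sq_lt y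
  unfold reach
  split_ifs with h1 h2 h2
  · exact iff_of_true (by nlinarith [sq_nonneg (2 - P.rad x), sq_nonneg (2 - P.rad y)])
      (by nlinarith)
  · exact iff_of_true (by nlinarith [sq_nonneg (2 - P.rad x)]) (by nlinarith)
  · exact iff_of_true (by nlinarith [sq_nonneg (2 - P.rad y)]) (by nlinarith)
  · constructor <;> intro h <;> linarith

theorem PolarData.eight_le_reach_add_reach (P : PolarData G) (x y : V) :
    8 ≤ P.reach x + P.reach y ↔ P.rad x + P.rad y ≤ 2 := by
  have hx := P.rad_pos x
  have hy := P.rad_pos y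
  have hx' := P.rad_lt_two x
  have hy' := P.rad_lt_two y
  unfold reach
  split_ifs with h1 h2 h2
  · exact iff_of_true (by nlinarith [sq_nonneg (2 - P.rad x), sq_nonneg (2 - P.rad y)])
      (by linarith)
  · constructor <;> intro h <;> nlinarith
  · constructor <;> intro h <;> nlinarith
  · constructor <;> intro h <;> nlinarith

theorem PolarData.isHGraph [Finite V] (P : PolarData G) : IsHGraph cycleWithFourRays G := by
  obtain ⟨K, r, hK, hr⟩ := exists_nat_radii P.reach P.reach_nonneg
  have h4 : ∀ x y, 4 * K ≤ r x + r y ↔ P.rad x ^ 2 + P.rad y ^ 2 ≤ 4 := fun x y => by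
    rw [← P.four_le_reach_add_reach]
    simpa using hr x y 4
  have h8 : ∀ x y, 2 * (4 * K) ≤ r x + r y ↔ P.rad x + P.rad y ≤ 2 := fun x y => by
    rw [← P.eight_le_reach_add_reach, ← mul_assoc]
    simpa using hr x y 8
  -- The diamond cycle has length 4 · 4K = 16K: the circle of length 16 scaled by `K`.
  obtain ⟨S⟩ := Diamond.nonempty_subdivision (M := 4 * K) (by omega)
  refine ⟨⟨Diamond (4 * K), diamondGraph (4 * K), S, fun x => Diamond.ball _ (r x) (P.dir x),
    fun x => Diamond.ball_connected _ _, fun x y hxy => ?_⟩⟩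
  have hdir : P.dir x = P.dir y ∨ P.dir y = P.dir x + 2 ∨ P.dir y = P.dir x + 1 ∨
      P.dir x = P.dir y + 1 := by omega
  rcases hdir with h | h | h | h
  · rw [h]
    exact iff_of_true (P.adj_of_dir_eq x y hxy h) (Diamond.ball_inter_same _ _ _)
  · rw [P.adj_iff_of_opposite x y h, h, Diamond.ball_inter_opposite, h8]
  · rw [P.adj_iff_of_next x y h, h, Diamond.ball_inter_next, h4]
  · rw [G.adj_comm, P.adj_iff_of_next y x h, h, Set.inter_comm, Diamond.ball_inter_next, h4]

end APUD

/-! ### Excluding `W₄`: the Helly arc model. -/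

namespace APUD
open SimpleGraph

variable {V : Type*} {G : SimpleGraph V}

/-- Radii summing to at most 2 leave one, say that of `x`, at most 1. Then `x` is adjacent to
everything in the neighbouring directions, since 1 + 3 ≤ 4, and to its own direction, so it is the
hub over a four-cycle through `y`. -/
theorem PolarData.not_adj_of_opposite (P : PolarData G) (hW : ¬ wheel4.IsIndContained G) {x y : V}
    (hxy : P.dir y = P.dir x + 2) : ¬ G.Adj x y := by
  intro h
  wlog hx : P.rad x ≤ 1 generalizing x y
  · have hle := (P.adj_iff_of_opposite x y hxy).1 h
    exact this (by rw [hxy]; omega) h.symm (by linarith)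
  obtain ⟨z, e, w, hz, he, hw, nye, nzw, hyz, hze, hew, hwy⟩ := P.exists_cycle y
  have hxe : G.Adj x e := by
    refine P.adj_of_dir_eq _ _ ?_ (by rw [he, hxy]; omega)
    rintro rfl
    exact nye h.symm
  have hxz : G.Adj x z := by
    refine ((P.adj_iff_of_next z x (by rw [hz, hxy]; omega)).2 ?_).symm
    nlinarith [P.rad_sq_lt z, P.rad_pos x]
  have hxw : G.Adj x w := by
    refine (P.adj_iff_of_next x w (by rw [hw, hxy]; omega)).2 ?_
    nlinarith [P.rad_sq_lt w, P.rad_pos x]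
  have hye : y ≠ e := by
    rintro rfl
    omega
  have hzw : z ≠ w := by
    rintro rfl
    omega
  have nye' : ¬ G.Adj e y := fun h => nye h.symm
  have nzw' : ¬ G.Adj w z := fun h => nzw h.symm
  let f : Option (Fin 4) → V
    | some i => ![y, z, e, w] i
    | none => x
  have hf : ∀ i j, G.Adj (f i) (f j) ↔ wheel4.Adj i j := by
    rintro (_ | i) (_ | j)
    · simp [f, wheel4]
    · fin_cases j <;> simp [f, wheel4, h, hxz, hxe, hxw]
    · fin_cases i <;> simp [f, wheel4, h.symm, hxz.symm, hxe.symm, hxw.symm]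
    · fin_cases i <;> fin_cases j <;>
        simp [f, wheel4, cycleGraph_adj, *, hyz.symm, hze.symm, hew.symm, hwy.symm] <;> decide
  have inj : Function.Injective f := by
    rintro (_ | i) (_ | j) hij
    · rfl
    · fin_cases j <;> simp [f] at hij <;> simp [hij] at h hxz hxe hxw
    · fin_cases i <;> simp [f] at hij <;> simp [hij] at h hxz hxe hxw
    · fin_cases i <;> fin_cases j <;> simp [f] at hij <;>
        first | rfl | (simp [hij] at hyz hze hew hwy hye hzw)
  exact hW ⟨⟨⟨f, inj⟩, hf _ _⟩⟩

/-- The arc of the circle of circumference one that reaches from `c / 4` by `r / 16` to both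
sides. -/
def centeredArc (c : Fin 4) (r : ℝ) : Set (AddCircle (1 : ℝ)) :=
  (fun t : ℝ => (t : AddCircle (1 : ℝ))) ''
    Set.Icc ((c : ℕ) / 4 - r / 16 : ℝ) ((c : ℕ) / 4 + r / 16)

theorem isArc_centeredArc (c : Fin 4) {r : ℝ} (hr : 0 ≤ r) : IsArc (centeredArc c r) :=
  ⟨_, _, by linarith, rfl⟩

theorem coe_mem_centeredArc {c : Fin 4} {r t : ℝ} (n : ℤ)
    (h : |t + n - (c : ℕ) / 4| ≤ r / 16) : (t : AddCircle (1 : ℝ)) ∈ centeredArc c r := by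
  rw [abs_le] at h
  exact ⟨t + n, ⟨by linarith, by linarith⟩, by simp⟩

/-- Here `m` is a lift of the difference of directions, counted in quarter turns. Its integrality
and residue mod 4 later rule out small values. -/
theorem exists_int_of_centeredArc_inter {c d : Fin 4} {r s : ℝ}
    (h : (centeredArc c r ∩ centeredArc d s).Nonempty) :
    ∃ m n : ℤ, m = (d : ℕ) - (c : ℕ) + 4 * n ∧ |(m : ℝ)| ≤ (r + s) / 4 := by
  obtain ⟨_, ⟨t, ht, rfl⟩, ⟨t', ht', htt⟩⟩ := h
  obtain ⟨n, hn⟩ := AddCircle.coe_eq_zero_iff 1 |>.1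
    (show ((t - t' : ℝ) : AddCircle (1 : ℝ)) = 0 by simpa [sub_eq_zero] using htt.symm)
  simp only [zsmul_eq_mul, mul_one] at hn
  refine ⟨_, n, rfl, ?_⟩
  push_cast
  rw [abs_le]
  constructor <;> linarith [ht.1, ht.2, ht'.1, ht'.2]

/-- A clique without opposite vertices lives in two neighbouring directions. -/
theorem PolarData.exists_directions (P : PolarData G)
    (hopp : ∀ x y, P.dir y = P.dir x + 2 → ¬ G.Adj x y) {Q : Set V} (hQ : G.IsClique Q) :
    ∃ h v : Fin 4, (h = 0 ∨ h = 2) ∧ (v = 1 ∨ v = 3) ∧ ∀ x ∈ Q, P.dir x = h ∨ P.dir x = v := by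
  have key : ∀ c, ∃ d, (d = c ∨ d = c + 2) ∧ ∀ x ∈ Q, P.dir x = c ∨ P.dir x = c + 2 →
      P.dir x = d := by
    intro c
    by_cases hc : ∃ x ∈ Q, P.dir x = c + 2
    · obtain ⟨x, hx, hxc⟩ := hc
      refine ⟨c + 2, Or.inr rfl, fun y hy hyc => hyc.resolve_left fun h => ?_⟩
      have hxy : P.dir x = P.dir y + 2 := by rw [hxc, h]
      refine hopp y x hxy (hQ hy hx ?_)
      rintro rfl
      omega
    · push Not at hc
      exact ⟨c, Or.inl rfl, fun y hy hyc => hyc.resolve_right (hc y hy)⟩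
  obtain ⟨h, hh, hQh⟩ := key 0
  obtain ⟨v, hv, hQv⟩ := key 1
  refine ⟨h, v, hh, hv, fun x hx => ?_⟩
  have : ∀ d : Fin 4, (d = 0 ∨ d = 0 + 2) ∨ (d = 1 ∨ d = 1 + 2) := by decide
  exact (this (P.dir x)).imp (hQh x hx) (hQv x hx)

/-- On the quarter circle from `h` to `v`, of length 4, arcs at `h` cover [0, 4 − rad²] and arcs at
`v` cover [rad², 4]. Adjacency across the two directions says that each rad² of the second kind is
at most each 4 − rad² of the first, so the smallest of the latter is a common point. -/
theorem PolarData.exists_mem_arcs [Finite V] (P : PolarData G)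
    (hopp : ∀ x y, P.dir y = P.dir x + 2 → ¬ G.Adj x y) {Q : Set V} (hQ : G.IsClique Q) :
    ∃ p, ∀ x ∈ Q, p ∈ centeredArc (P.dir x) (4 - P.rad x ^ 2) := by
  obtain ⟨h, v, hh, hv, hhv⟩ := P.exists_directions hopp hQ
  have hadj : ∀ x ∈ Q, ∀ y ∈ Q, P.dir x = h → P.dir y = v → P.rad x ^ 2 + P.rad y ^ 2 ≤ 4 := by
    intro x hx y hy hxh hyv
    have hxy : x ≠ y := by
      rintro rfl
      omega
    have h4 : P.dir y = P.dir x + 1 ∨ P.dir x = P.dir y + 1 := by omega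
    rcases h4 with h4 | h4
    · exact (P.adj_iff_of_next x y h4).1 (hQ hx hy hxy)
    · linarith [(P.adj_iff_of_next y x h4).1 (hQ hy hx hxy.symm)]
  obtain ⟨t, ht0, ht4, hth, htv⟩ : ∃ t : ℝ, 0 ≤ t ∧ t ≤ 4 ∧
      (∀ x ∈ Q, P.dir x = h → t ≤ 4 - P.rad x ^ 2) ∧
      (∀ x ∈ Q, P.dir x = v → P.rad x ^ 2 ≤ t) := by
    by_cases hne : {x | x ∈ Q ∧ P.dir x = h}.Nonempty
    · obtain ⟨x, ⟨hx, hxh⟩, hmin⟩ := Set.exists_min_image _ (fun x => 4 - P.rad x ^ 2)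
        (Set.toFinite _) hne
      refine ⟨4 - P.rad x ^ 2, by linarith [P.rad_sq_lt x], by linarith [sq_nonneg (P.rad x)],
        fun y hy hyh => hmin y ⟨hy, hyh⟩, fun y hy hyv => ?_⟩
      linarith [hadj x hx y hy hxh hyv]
    -- With no vertex in direction `h`, the center of the arcs at `v` serves.
    · refine ⟨4, by norm_num, le_rfl, fun x hx hxh => (hne ⟨x, hx, hxh⟩).elim, fun x _ _ => ?_⟩
      linarith [P.rad_sq_lt x]
  have key : ∀ (s : ℝ) (k n : ℤ), (∀ r, t ≤ r → |s + k - (h : ℕ) / 4| ≤ r / 16) →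
      (∀ r, 4 - t ≤ r → |s + n - (v : ℕ) / 4| ≤ r / 16) →
      ∃ p, ∀ x ∈ Q, p ∈ centeredArc (P.dir x) (4 - P.rad x ^ 2) := by
    intro s k n hs hs'
    refine ⟨(s : ℝ), fun x hx => ?_⟩
    rcases hhv x hx with hxh | hxv
    · exact coe_mem_centeredArc k (hxh ▸ hs _ (hth x hx hxh))
    · exact coe_mem_centeredArc n (hxv ▸ hs' _ (by linarith [htv x hx hxv]))
  rcases hh with rfl | rfl <;> rcases hv with rfl | rfl
  · refine key (t / 16) 0 0 ?_ ?_ <;> intro r hr <;> rw [abs_le] <;> norm_num <;>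
      constructor <;> linarith
  -- Between directions 0 and 3 the quarter circle crosses 0, so the point needs a full turn to be
  -- compared with 3/4.
  · refine key (-t / 16) 0 1 ?_ ?_ <;> intro r hr <;> rw [abs_le] <;> norm_num <;>
      constructor <;> linarith
  · refine key (1 / 2 - t / 16) 0 0 ?_ ?_ <;> intro r hr <;> rw [abs_le] <;> norm_num <;>
      constructor <;> linarith
  · refine key (1 / 2 + t / 16) 0 0 ?_ ?_ <;> intro r hr <;> rw [abs_le] <;> norm_num <;>
      constructor <;> linarith

theorem PolarData.isHellyCircularArc [Finite V] (P : PolarData G)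
    (hopp : ∀ x y, P.dir y = P.dir x + 2 → ¬ G.Adj x y) : IsHellyCircularArc G := by
  refine ⟨fun x => centeredArc (P.dir x) (4 - P.rad x ^ 2),
    fun x => isArc_centeredArc _ (by linarith [P.rad_sq_lt x]), fun x y hxy => ⟨fun h => ?_, ?_⟩,
    fun Q hQ => P.exists_mem_arcs hopp hQ⟩
  · have hQ : G.IsClique {x, y} := by simp [hxy, h]
    obtain ⟨p, hp⟩ := P.exists_mem_arcs hopp hQ
    exact ⟨p, hp x (by simp), hp y (by simp)⟩
  · contrapose
    rintro hn h
    obtain ⟨m, n, hm, hle⟩ := exists_int_of_centeredArc_inter h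
    have h4 : P.dir x = P.dir y ∨ P.dir y = P.dir x + 2 ∨ P.dir y = P.dir x + 1 ∨
        P.dir x = P.dir y + 1 := by omega
    have hx := P.rad_pos x
    have hy := P.rad_pos y
    rcases h4 with h4 | h4 | h4
    · exact hn (P.adj_of_dir_eq x y hxy h4)
    -- Both reaches are below 4, so opposite arcs, with `m` ≡ 2 mod 4, never meet.
    · have : |(m : ℝ)| < 2 := hle.trans_lt (by linarith [pow_pos hx 2, pow_pos hy 2])
      have : |m| < 2 := by exact_mod_cast this
      rw [abs_lt] at this
      omega
    · have hfar : 4 < P.rad x ^ 2 + P.rad y ^ 2 := by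
        rcases h4 with h4 | h4
        · exact not_le.1 (mt (P.adj_iff_of_next x y h4).2 hn)
        · linarith [not_le.1 (mt (P.adj_iff_of_next y x h4).2 (mt G.adj_symm hn))]
      have : |(m : ℝ)| < 1 := hle.trans_lt (by linarith)
      have : |m| < 1 := by exact_mod_cast this
      rw [Int.abs_lt_one_iff] at this
      omega

theorem IsHellyCircularArc.induce (h : IsHellyCircularArc G) (s : Set V) :
    IsHellyCircularArc (G.induce s) := by
  obtain ⟨arc, harc, hadj, hclique⟩ := h
  refine ⟨fun x => arc x, fun x => harc x, fun x y hxy => hadj x y (Subtype.coe_injective.ne hxy),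
    fun Q hQ => ?_⟩
  obtain ⟨p, hp⟩ := hclique (Subtype.val '' Q) (by
    rintro _ ⟨x, hx, rfl⟩ _ ⟨y, hy, rfl⟩ hxy
    exact hQ hx hy (fun h => hxy (congrArg _ h)))
  exact ⟨p, fun x hx => hp x ⟨x, hx, rfl⟩⟩

end APUD

theorem mainTheorem8 {V : Type*} [Finite V] (G : SimpleGraph V)
    (hconn : G.Connected) (hG : APUD.IsAPUD11 G) :
    APUD.IsHGraph APUD.cycleWithFourRays (G.induce (APUD.inducedC4Vertices G)) ∧
    (¬ APUD.wheel4.IsIndContained (G.induce (APUD.inducedC4Vertices G)) →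
      ∀ R : APUD.HRepresentation APUD.cycleWithFourRays
          (G.induce (APUD.inducedC4Vertices G)),
        APUD.IsHellyCircularArc
          ((G.induce (APUD.inducedC4Vertices G)).induce R.onCycle)) := by
  obtain ⟨P⟩ := APUD.PolarData.nonempty_of_isAPUD11 hG
  exact ⟨P.isHGraph, fun hW R =>
    (P.isHellyCircularArc fun _ _ h => P.not_adj_of_opposite hW h).induce R.onCycle⟩
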